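/- Let $p,q,n,m$ be positive integers with $\gcd(n,m)=1$ and $m>2$. Let $A\in SO(3)$ be the rotation by $2\pi/p$ about the $x$-axis, let $\ell$ be the line through the origin in the $x$-$y$ plane at angle $2\pi n/m$ to the $x$-axis, let $B\in SO(3)$ be the rotation by $2\pi/q$ about $\ell$, and let $G_{n/m}(p,q)=\langle A,B\rangle\subseteq SO(3)$. Write $\mathbb{Z}_k$ for the cyclic group of order $k$ and $D_q=\langle\rho,\sigma:\rho^q,\sigma^2,(\rho\sigma)^2\rangle$ for the dihedral group of order $2q$. (1) If $p$ and $q$ are both odd, or if $p$ is even, $q$ is odd and $m\neq 4$, then $$G_{n/m}(p,q)\cong\langle\alpha,\beta:\alpha^p,\beta^q\rangle=\mathbb{Z}_p*\mathbb{Z}_q,$$ where $\alpha$ (the generator of $\mathbb{Z}_p$) corresponds to $A$ and $\beta$ (the generator of $\mathbb{Z}_q$) to $B$. (2) If $p$ is even, $q$ is odd and $m=4$, then $$G_{n/m}(p,q)\cong\langle\alpha,\beta:\alpha^p,\beta^q,(\alpha^{p/2}\beta)^2\rangle=\mathbb{Z}_p*_{\mathbb{Z}_2}D_q,$$ where $\alpha$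 corresponds to $A$ and $\beta$ to $B$. In the amalgamated free product the common subgroup $\mathbb{Z}_2$ is the subgroup of order two of $\mathbb{Z}_p$, identified with the subgroup $\{1,\sigma\}$ of $D_q$; the generator of $\mathbb{Z}_p$ corresponds to $A$, $\rho$ to $B$, and $\sigma$ to $A^{p/2}$. -/

import Mathlib

/-- The rotation group `SO(3)`. -/
abbrev SO3 : Type := Matrix.specialOrthogonalGroup (Fin 3) ℝ

/-- The matrix of the rotation by the angle `θ` (counterclockwise, seen from the tip of `u`) about
the oriented axis spanned by the unit vector `u` (Rodrigues' formula):
`cos θ • 1 + sin θ • [u]ₓ + (1 - cos θ) • u uᵀ`. -/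
noncomputable def rotationMatrix (u : Fin 3 → ℝ) (θ : ℝ) : Matrix (Fin 3) (Fin 3) ℝ :=
  Real.cos θ • (1 : Matrix (Fin 3) (Fin 3) ℝ)
    + Real.sin θ • !![0, -u 2, u 1; u 2, 0, -u 0; -u 1, u 0, 0]
    + (1 - Real.cos θ) • Matrix.vecMulVec u u

theorem rotationMatrix_mem (u : Fin 3 → ℝ) (hu : u ⬝ᵥ u = 1) (θ : ℝ) :
    rotationMatrix u θ ∈ Matrix.specialOrthogonalGroup (Fin 3) ℝ := by
  have h1 : u 0 * u 0 + u 1 * u 1 + u 2 * u 2 = 1 := by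
    simpa [dotProduct, Fin.sum_univ_three] using hu
  have h2 := Real.sin_sq_add_cos_sq θ
  rw [Matrix.mem_specialOrthogonalGroup_iff, Matrix.mem_orthogonalGroup_iff]
  generalize hs : Real.sin θ = s at *
  generalize hc : Real.cos θ = c at *
  generalize hx : u 0 = x at *
  generalize hy : u 1 = y at *
  generalize hz : u 2 = z at *
  constructor
  · ext i j
    fin_cases i <;> fin_cases j <;>
      simp [rotationMatrix, Matrix.mul_apply, Fin.sum_univ_three, Matrix.vecMulVec_apply,
        hs, hc, hx, hy, hz] <;> grind
  · rw [Matrix.det_fin_three]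
    simp [rotationMatrix, Matrix.vecMulVec_apply, hs, hc, hx, hy, hz]
    grind

/-- The rotation by `θ` about the axis spanned by the unit vector `u`, as an element of `SO(3)`. -/
noncomputable def rotationAbout (u : Fin 3 → ℝ) (hu : u ⬝ᵥ u = 1) (θ : ℝ) : SO3 :=
  ⟨rotationMatrix u θ, rotationMatrix_mem u hu θ⟩

/-- The unit vector in the `x`-`y` plane that makes the angle `φ` with the `x`-axis. -/
noncomputable def planeAxis (φ : ℝ) : Fin 3 → ℝ := ![Real.cos φ, Real.sin φ, 0]

theorem planeAxis_unit (φ : ℝ) : planeAxis φ ⬝ᵥ planeAxis φ = 1 := by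
  simp [planeAxis, dotProduct, Fin.sum_univ_three, ← sq]

/-- `A`: the rotation by `2π/p` about the `x`-axis. -/
noncomputable def rotA (p : ℕ) : SO3 :=
  rotationAbout ![1, 0, 0] (by simp) (2 * Real.pi / p)

/-- `B`: the rotation by `2π/q` about the line `ℓ` through the origin of the `x`-`y` plane at the
angle `2πn/m` to the `x`-axis. -/
noncomputable def rotB (n m q : ℕ) : SO3 :=
  rotationAbout (planeAxis (2 * Real.pi * n / m)) (planeAxis_unit _) (2 * Real.pi / q)

/-- `G_{n/m}(p,q)`: the subgroup of `SO(3)` generated by `A` and `B`. -/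
noncomputable def rotGroup (n m p q : ℕ) : Subgroup SO3 :=
  Subgroup.closure {rotA p, rotB n m q}

/-- The relators `α^p, β^q`, where `α` and `β` are the generators `0` and `1` of the free group. -/
def freeProductRels (p q : ℕ) : Set (FreeGroup (Fin 2)) :=
  {FreeGroup.of 0 ^ p, FreeGroup.of 1 ^ q}

/-- The relators `α^p, β^q, (α^{p/2} β)^2` (used for even `p`). -/
def amalgamRels (p q : ℕ) : Set (FreeGroup (Fin 2)) :=
  {FreeGroup.of 0 ^ p, FreeGroup.of 1 ^ q, (FreeGroup.of 0 ^ (p / 2) * FreeGroup.of 1) ^ 2}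

/-- The cyclic group of order `k`, written multiplicatively. -/
abbrev Cyc (k : ℕ) : Type := Multiplicative (ZMod k)

/-- The standard generator of `Cyc k`. -/
def cycGen (k : ℕ) : Cyc k := Multiplicative.ofAdd 1

/-- The homomorphism `Z_2 → K` that sends the nontrivial element to `g`, where `g ^ 2 = 1`. -/
def involutionHom {K : Type} [Group K] (g : K) (hg : g ^ 2 = 1) : Cyc 2 →* K where
  toFun x := g ^ (Multiplicative.toAdd x).val
  map_one' := by simp
  map_mul' x y := by
    rw [← pow_add, toAdd_mul, ZMod.val_add, ← pow_eq_pow_mod _ hg]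

/-- The two factors `Z_p` (index `false`) and `D_q` (index `true`). -/
def Factor (p q : ℕ) : Bool → Type
  | false => Cyc p
  | true => DihedralGroup q

instance (p q : ℕ) : ∀ i, Group (Factor p q i)
  | false => inferInstanceAs (Group (Cyc p))
  | true => inferInstanceAs (Group (DihedralGroup q))

theorem cycGen_half_sq (p : ℕ) (hp : Even p) : (cycGen p ^ (p / 2)) ^ 2 = 1 := by
  rw [← pow_mul, Nat.div_mul_cancel hp.two_dvd, cycGen, ← ofAdd_nsmul]
  simp

/-- The two maps from `Z_2`: onto the subgroup of order two of `Z_p` (`p` even), and onto the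
subgroup of `D_q` generated by the reflection `sr 0`. -/
def amalgamMap (p q : ℕ) (hp : Even p) : ∀ i, Cyc 2 →* Factor p q i
  | false => (involutionHom (cycGen p ^ (p / 2)) (cycGen_half_sq p hp) : Cyc 2 →* Cyc p)
  | true => (involutionHom (DihedralGroup.sr 0) (by rw [sq, DihedralGroup.sr_mul_self]) :
      Cyc 2 →* DihedralGroup q)

/-- The amalgamated free product `Z_p *_{Z_2} D_q`, for even `p`. -/
abbrev Amalgam (p q : ℕ) (hp : Even p) : Type := Monoid.PushoutI (amalgamMap p q hp)

/-- The canonical map `Z_p → Z_p *_{Z_2} D_q`. -/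
def Amalgam.ofCyc (p q : ℕ) (hp : Even p) : Cyc p →* Amalgam p q hp :=
  Monoid.PushoutI.of (φ := amalgamMap p q hp) false

/-- The canonical map `D_q → Z_p *_{Z_2} D_q`. -/
def Amalgam.ofDihedral (p q : ℕ) (hp : Even p) : DihedralGroup q →* Amalgam p q hp :=
  Monoid.PushoutI.of (φ := amalgamMap p q hp) true

/-! The proof is a 2-adic ping-pong. Up to scalars, a rotation lifts to a complex `2 × 2` matrix:
`A` to `diag(ξ, 1)` and `B` to `1 + (η - 1)P`, with `ξ`, `η` primitive roots of unity of orders `p`,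
`q`. Here `P` is the projection with first column `(κ, s)`, `κ = (1 + cos φ)/2`, `s = (sin φ)/2`, `φ
= 2πn/m`. In the basis `e = (1, 0)`, `f = (κ, s)`, the power `A^k` fixes `β` in `αe + βf` and sends
`α` to `ξ^k α + (ξ^k - 1)κβ`, while `B^k` fixes `α` and sends `β` to `η^k β + (η^k - 1)α`.

Take a valuation `v` of `ℂ` with `v 2 < 1`. As `q` is odd, `v (η^k - 1) = 1` whenever `η^k ≠ 1`. If
also `v ((ξ^k - 1)κ) > 1`, then powers of `A` produce `v β < v α` and powers of `B` produce `v α ≤ v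
β` with `β ≠ 0`. Hence an alternating word starting with `B` has lower left entry `βs ≠ 0`, so it is
not scalar and its rotation is not `1` (`IsAltWord.exists_implements`).

With `w = exp(iφ)`, the identity `(1 + w)² = 4κw` reduces the estimate to bounds on `v (z - 1)` for
roots of unity `z` (`Valuation.two_lt_map_sub_one`, `Valuation.two_lt_map_sub_one_sq`). It fails
only for `p` even, `m = 4` and `ξ^k = -1`. Then `A^(p/2)` is a half turn about an axis perpendicular
to that of `B`, so it inverts `B`; this is the extra relation. In both cases the relations bring
every element to the form `a^k w` with `w` empty or alternating (`hasNormalForm_of_closure_eq_top`),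
so `exists_mulEquiv_rotGroup` yields injectivity. -/

/-! ### A 2-adic valuation of `ℂ` and its values at roots of unity. -/

/-- Since `2` is not a unit of `ℤ`, some valuation ring of `ℂ` has `2` among its nonunits. -/
theorem exists_valuationSubring_two_lt_one :
    ∃ V : ValuationSubring ℂ, V.valuation 2 < 1 := by
  have h2 : (2 : ℂ) ∈ (Int.castRingHom ℂ).range := ⟨2, by simp⟩
  have hI : Ideal.span {(⟨2, h2⟩ : (Int.castRingHom ℂ).range)} ≠ ⊤ := by
    rw [Ne, Ideal.span_singleton_eq_top, isUnit_iff_exists_inv]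
    rintro ⟨⟨_, k, rfl⟩, hk⟩
    have h : (2 : ℂ) * (k : ℂ) = 1 := congrArg Subtype.val hk
    have h' : (2 * k : ℤ) = 1 := by exact_mod_cast h
    omega
  obtain ⟨V, -, hV⟩ := Ideal.image_subset_nonunits_valuationSubring _ hI
  exact ⟨V, (V.mem_nonunits_iff).1 (hV ⟨_, Ideal.subset_span rfl, rfl⟩)⟩

section RootsOfUnity

variable {K Γ : Type*} [Field K] [LinearOrderedCommGroupWithZero Γ] (v : Valuation K Γ)

theorem Valuation.map_eq_one_of_pow_eq_one {z : K} {n : ℕ} (hn : n ≠ 0) (hz : z ^ n = 1) :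
    v z = 1 := by
  have h : v z ^ n = 1 := by rw [← map_pow, hz, map_one]
  exact (pow_eq_one_iff_of_nonneg zero_le hn).1 h

theorem Valuation.map_natCast_le_one (n : ℕ) : v (n : K) ≤ 1 := by
  induction n with
  | zero => simp
  | succ n ih => push_cast; exact v.map_add_le ih (by simp)

theorem Valuation.map_odd_natCast (h2 : v 2 < 1) {r : ℕ} (hr : Odd r) : v (r : K) = 1 := by
  obtain ⟨k, rfl⟩ := hr
  push_cast
  rw [add_comm]
  refine v.map_one_add_of_lt ?_
  rw [map_mul]
  exact mul_lt_one_of_lt_of_le h2 (v.map_natCast_le_one k)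

theorem Valuation.map_pow_sub_one_le {z : K} (hz : v z ≤ 1) (k : ℕ) :
    v (z ^ k - 1) ≤ v (z - 1) := by
  rw [← geom_sum_mul, map_mul]
  refine mul_le_of_le_one_left' (v.map_sum_le fun i _ => ?_)
  rw [map_pow]
  exact pow_le_one' hz i

/-- The powers `z^i`, `i < r`, sum to `0`, so the differences `z^i - 1` sum to `-r`, which has value
`1`. Each difference is at most `v (z - 1)`, which therefore cannot be below `1`. -/
theorem Valuation.map_sub_one_of_odd_pow (h2 : v 2 < 1) {z : K} {r : ℕ} (hr : Odd r)
    (hz : z ^ r = 1) (hz1 : z ≠ 1) : v (z - 1) = 1 := by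
  have hv : v z = 1 := v.map_eq_one_of_pow_eq_one hr.pos.ne' hz
  refine le_antisymm (v.map_sub_le hv.le (by simp)) (not_lt.1 fun hlt => ?_)
  have hsum : ∑ i ∈ Finset.range r, z ^ i = 0 := by
    have := geom_sum_mul z r
    rw [hz, sub_self] at this
    exact (mul_eq_zero.1 this).resolve_right (sub_ne_zero.2 hz1)
  have hsum' : ∑ i ∈ Finset.range r, (z ^ i - 1) = -(r : K) := by
    rw [Finset.sum_sub_distrib, hsum]; simp
  have h1 : v (∑ i ∈ Finset.range r, (z ^ i - 1)) < 1 :=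
    v.map_sum_lt one_ne_zero fun i _ => (v.map_pow_sub_one_le hv.le i).trans_lt hlt
  rw [hsum', Valuation.map_neg, v.map_odd_natCast h2 hr] at h1
  exact lt_irrefl _ h1

/-- Passing to a power of `z` can only decrease `v (z - 1)`. If `4` divides the order, some power is
a square root `i` of `-1`, and `(i - 1)² = -2i` gives `v (i - 1)² = v 2`, too large if `v (i - 1) ≤
v 2`. Otherwise `z²` has odd order and `v (z² - 1) = 1`. -/
theorem Valuation.two_lt_map_sub_one [CharZero K] (h2 : v 2 < 1) {z : K} {n : ℕ} (hn : n ≠ 0)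
    (hz : z ^ n = 1) (hz1 : z ≠ 1) (hz2 : z ≠ -1) : v 2 < v (z - 1) := by
  by_contra! hle
  have hv : v z = 1 := v.map_eq_one_of_pow_eq_one hn hz
  have h0 : v 2 ≠ 0 := (Valuation.ne_zero_iff v).2 two_ne_zero
  have hN : 0 < orderOf z := orderOf_pos_iff.2 (isOfFinOrder_iff_pow_eq_one.2 ⟨n, by omega, hz⟩)
  have hzN := pow_orderOf_eq_one z
  by_cases h4 : 4 ∣ orderOf z
  · obtain ⟨k, hk⟩ := h4
    have hsq : (z ^ k) ^ 2 = -1 := by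
      have h : ((z ^ k) ^ 2) ^ 2 = 1 := by
        rw [← pow_mul, ← pow_mul, show k * (2 * 2) = orderOf z by omega, hzN]
      rcases sq_eq_sq_iff_eq_or_eq_neg.1 (h.trans (one_pow 2).symm) with h | h
      · rw [← pow_mul] at h
        exact absurd (Nat.le_of_dvd (by omega) (orderOf_dvd_of_pow_eq_one h)) (by omega)
      · exact h
    have h3 : v (z ^ k - 1) ≤ v 2 := (v.map_pow_sub_one_le hv.le k).trans hle
    have h4 : v (z ^ k - 1) ^ 2 = v 2 := by
      rw [← map_pow, show (z ^ k - 1) ^ 2 = -(2 * z ^ k) by linear_combination hsq,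
        Valuation.map_neg, map_mul, map_pow, hv, one_pow, mul_one]
    have h5 : v 2 ≤ v 2 * v 2 := by
      conv_lhs => rw [← h4, sq]
      exact mul_le_mul' h3 h3
    exact absurd h5 (not_le.2 (mul_lt_of_lt_one_right (zero_lt_iff.2 h0) h2))
  · have key : ∃ r, Odd r ∧ (z ^ 2) ^ r = 1 := by
      rcases Nat.even_or_odd' (orderOf z) with ⟨r, hr | hr⟩
      · exact ⟨r, Nat.not_even_iff_odd.1 fun h => h4 (by rw [hr]; obtain ⟨s, rfl⟩ := h; omega),
          by rw [← pow_mul, ← hr, hzN]⟩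
      · exact ⟨orderOf z, ⟨r, hr⟩, by rw [← pow_mul, mul_comm, pow_mul, hzN, one_pow]⟩
    obtain ⟨r, hr, hzr⟩ := key
    by_cases h : z ^ 2 = 1
    · rcases sq_eq_sq_iff_eq_or_eq_neg.1 (h.trans (one_pow 2).symm) with h | h
      · exact hz1 h
      · exact hz2 h
    · have := v.map_sub_one_of_odd_pow h2 hr hzr h
      exact absurd ((v.map_pow_sub_one_le hv.le 2).trans hle) (not_le.2 (this ▸ h2))

theorem Valuation.two_le_map_sub_one [CharZero K] (h2 : v 2 < 1) {z : K} {n : ℕ} (hn : n ≠ 0)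
    (hz : z ^ n = 1) (hz1 : z ≠ 1) : v 2 ≤ v (z - 1) := by
  by_cases h : z = -1
  · rw [h, show (-1 - 1 : K) = -2 by norm_num, Valuation.map_neg]
  · exact (v.two_lt_map_sub_one h2 hn hz hz1 h).le

/-- Since `z + 1` and `z - 1` differ by `2`, which is smaller than either, they have the same value.
So `v (z - 1)²` is `v (z² - 1)`, and the previous bound applies to `z²`. -/
theorem Valuation.two_lt_map_sub_one_sq [CharZero K] (h2 : v 2 < 1) {z : K} {n : ℕ} (hn : n ≠ 0)
    (hz : z ^ n = 1) (hz4 : z ^ 4 ≠ 1) : v 2 < v (z - 1) ^ 2 := by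
  have hv : v z = 1 := v.map_eq_one_of_pow_eq_one hn hz
  have h1 : v 2 < v (z - 1) :=
    v.two_lt_map_sub_one h2 hn hz (by rintro rfl; simp at hz4) (by rintro rfl; norm_num at hz4)
  have h3 : v (z + 1) = v (z - 1) := by
    rw [show z + 1 = (z - 1) + 2 by ring]
    exact v.map_add_eq_of_lt_left h1
  have h4 : v 2 < v (z ^ 2 - 1) := by
    refine v.two_lt_map_sub_one h2 hn (by rw [← pow_mul, mul_comm, pow_mul, hz, one_pow]) ?_ ?_
    · intro h; exact hz4 (by rw [show (4 : ℕ) = 2 * 2 from rfl, pow_mul, h, one_pow])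
    · intro h; exact hz4 (by rw [show (4 : ℕ) = 2 * 2 from rfl, pow_mul, h]; norm_num)
  rwa [show z ^ 2 - 1 = (z + 1) * (z - 1) by ring, map_mul, h3, ← sq] at h4

end RootsOfUnity

/-! ### Normal forms in a two-generator group. -/

section AlternatingWords

variable {G : Type*} [Group G]

/-- Nonempty alternating products of powers `a ^ k` with `h ∤ k` and `b ^ k` with `q ∤ k`. The flag
is `true` if the leftmost factor is a power of `b`. -/
inductive IsAltWord (a b : G) (h q : ℕ) : Bool → G → Prop
  | left_pow {k : ℕ} (hk : ¬ h ∣ k) : IsAltWord a b h q false (a ^ k)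
  | left_mul {k : ℕ} {w : G} (hk : ¬ h ∣ k) (hw : IsAltWord a b h q true w) :
      IsAltWord a b h q false (a ^ k * w)
  | right_pow {k : ℕ} (hk : ¬ q ∣ k) : IsAltWord a b h q true (b ^ k)
  | right_mul {k : ℕ} {w : G} (hk : ¬ q ∣ k) (hw : IsAltWord a b h q false w) :
      IsAltWord a b h q true (b ^ k * w)

/-- Products of a power of `a` and a possibly empty alternating word that starts with `b`. -/
def HasNormalForm (a b : G) (h q : ℕ) (g : G) : Prop :=
  ∃ (k : ℕ) (w : G), g = a ^ k * w ∧ (w = 1 ∨ IsAltWord a b h q true w)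

variable {a b : G} {h q : ℕ}

theorem IsAltWord.hasNormalForm {st : Bool} {g : G} (hg : IsAltWord a b h q st g) :
    HasNormalForm a b h q g := by
  cases hg with
  | left_pow hk => exact ⟨_, 1, (mul_one _).symm, .inl rfl⟩
  | left_mul hk hw => exact ⟨_, _, rfl, .inr hw⟩
  | right_pow hk => exact ⟨0, _, by simp, .inr (.right_pow hk)⟩
  | right_mul hk hw => exact ⟨0, _, by simp, .inr (.right_mul hk hw)⟩

theorem HasNormalForm.pow_left_mul {g : G} (hg : HasNormalForm a b h q g) (j : ℕ) :
    HasNormalForm a b h q (a ^ j * g) := by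
  obtain ⟨k, w, rfl, hw⟩ := hg
  exact ⟨j + k, w, by rw [pow_add, mul_assoc], hw⟩

theorem pow_eq_one_of_dvd {x : G} {n k : ℕ} (hx : x ^ n = 1) (hk : n ∣ k) : x ^ k = 1 := by
  obtain ⟨c, rfl⟩ := hk
  rw [pow_mul, hx, one_pow]

theorem hasNormalForm_right_pow_mul (hb : b ^ q = 1) (j : ℕ) {w : G}
    (hw : w = 1 ∨ IsAltWord a b h q true w) : HasNormalForm a b h q (b ^ j * w) := by
  have hpow : ∀ i : ℕ, HasNormalForm a b h q (b ^ i) := fun i => by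
    by_cases hi : q ∣ i
    · exact ⟨0, 1, by rw [pow_eq_one_of_dvd hb hi]; simp, .inl rfl⟩
    · exact (IsAltWord.right_pow hi).hasNormalForm
  rcases hw with rfl | hw
  · rw [mul_one]; exact hpow j
  · cases hw with
    | right_pow hk => rw [← pow_add]; exact hpow _
    | @right_mul k w hk hw =>
      rw [← mul_assoc, ← pow_add]
      by_cases hi : q ∣ j + k
      · rw [pow_eq_one_of_dvd hb hi, one_mul]; exact hw.hasNormalForm
      · exact (IsAltWord.right_mul hi hw).hasNormalForm

/-- If `h ∣ k`, then `b` moves past `a^k`, becoming some `b^i` that merges with the word behind it.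
If not, `a^k` is a legitimate letter and `b` starts a longer word. -/
theorem HasNormalForm.right_mul {e : ℕ} (hb : b ^ q = 1) (hab : b * a ^ h = a ^ h * b ^ e) {g : G}
    (hg : HasNormalForm a b h q g) : HasNormalForm a b h q (b * g) := by
  obtain ⟨k, w, rfl, hw⟩ := hg
  by_cases hk : h ∣ k
  · obtain ⟨t, rfl⟩ := hk
    have hpow : ∀ i : ℕ, b ^ i * a ^ h = a ^ h * b ^ (e * i) := fun i => by
      induction i with
      | zero => simp
      | succ i ih => rw [pow_succ, mul_assoc, hab, ← mul_assoc, ih, mul_assoc, ← pow_add,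
          Nat.mul_succ]
    have hmul : ∃ i : ℕ, b * a ^ (h * t) = a ^ (h * t) * b ^ i := by
      induction t with
      | zero => exact ⟨1, by simp⟩
      | succ t ih =>
        obtain ⟨i, hi⟩ := ih
        exact ⟨e * i, by rw [Nat.mul_succ, pow_add, ← mul_assoc, hi, mul_assoc, hpow, mul_assoc]⟩
    obtain ⟨i, hi⟩ := hmul
    rw [← mul_assoc, hi, mul_assoc]
    exact (hasNormalForm_right_pow_mul hb i hw).pow_left_mul _
  -- For `q = 1` the generator `b` is trivial and is not an admissible letter.
  · by_cases hq : q ∣ 1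
    · have hb1 : b = 1 := by simpa using pow_eq_one_of_dvd hb hq
      rw [show b * (a ^ k * w) = a ^ k * w by rw [hb1, one_mul]]
      exact ⟨k, w, rfl, hw⟩
    · rcases hw with rfl | hw
      · rw [mul_one]
        have := IsAltWord.right_mul hq (IsAltWord.left_pow (a := a) (b := b) hk)
        rw [pow_one] at this
        exact this.hasNormalForm
      · have := IsAltWord.right_mul hq (IsAltWord.left_mul hk hw)
        rw [pow_one] at this
        exact this.hasNormalForm

theorem hasNormalForm_of_closure_eq_top {p e : ℕ} (hp : 0 < p) (hq : 0 < q)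
    (hgen : Subgroup.closure {a, b} = ⊤) (ha : a ^ p = 1) (hb : b ^ q = 1)
    (hab : b * a ^ h = a ^ h * b ^ e) (g : G) : HasNormalForm a b h q g := by
  have hg : g ∈ Subgroup.closure {a, b} := hgen ▸ Subgroup.mem_top g
  have hbmul : ∀ (i : ℕ) {x : G}, HasNormalForm a b h q x → HasNormalForm a b h q (b ^ i * x) := by
    intro i x hx
    induction i with
    | zero => simpa using hx
    | succ i ih => rw [pow_succ', mul_assoc]; exact ih.right_mul hb hab
  induction hg using Subgroup.closure_induction_left with
  | one => exact ⟨0, 1, by simp, .inl rfl⟩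
  | mul_left x hx y _ ih =>
    rcases hx with rfl | rfl
    · simpa using ih.pow_left_mul 1
    · exact ih.right_mul hb hab
  | inv_mul_cancel x hx y _ ih =>
    rcases hx with rfl | rfl
    · rw [inv_eq_of_mul_eq_one_right (b := x ^ (p - 1)) (by rw [← pow_succ', Nat.sub_add_cancel hp, ha])]
      exact ih.pow_left_mul _
    · rw [inv_eq_of_mul_eq_one_right (b := x ^ (q - 1)) (by rw [← pow_succ', Nat.sub_add_cancel hq, hb])]
      exact hbmul _ ih

end AlternatingWords

/-! ### Lifting rotations to complex `2 × 2` matrices. -/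

/-- The traceless Hermitian `2 × 2` matrix attached to a vector of `ℝ³`; the first coordinate axis
corresponds to `diag(1, -1)`. -/
noncomputable def pauli (x : Fin 3 → ℝ) : Matrix (Fin 2) (Fin 2) ℂ :=
  !![(x 0 : ℂ), x 1 + Complex.I * x 2; x 1 - Complex.I * x 2, -(x 0 : ℂ)]

/-- The matrix with eigenvalues `ξ` and `1` on the two eigenlines of `pauli u`, for unit `u`. -/
noncomputable def spinor (u : Fin 3 → ℝ) (ξ : ℂ) : Matrix (Fin 2) (Fin 2) ℂ :=
  1 + ((ξ - 1) / 2) • (1 + pauli u)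

/-- `M` intertwines the actions of the rotation `R` on `ℝ³` and of `M` on Pauli matrices. -/
def Implements (M : Matrix (Fin 2) (Fin 2) ℂ) (R : SO3) : Prop :=
  ∀ x : Fin 3 → ℝ, M * pauli x = pauli (R.1.mulVec x) * M

theorem Implements.mul {M N : Matrix (Fin 2) (Fin 2) ℂ} {R S : SO3} (hM : Implements M R)
    (hN : Implements N S) : Implements (M * N) (R * S) := by
  intro x
  rw [mul_assoc, hN, ← mul_assoc, hM, mul_assoc, Submonoid.coe_mul, Matrix.mulVec_mulVec]

theorem implements_one : Implements 1 1 := fun x => by simp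

theorem Implements.pow {M : Matrix (Fin 2) (Fin 2) ℂ} {R : SO3} (hM : Implements M R) (k : ℕ) :
    Implements (M ^ k) (R ^ k) := by
  induction k with
  | zero => simpa using implements_one
  | succ k ih => rw [pow_succ, pow_succ]; exact ih.mul hM

theorem pauli_injective : Function.Injective pauli := by
  intro x y hxy
  have h0 := congrFun (congrFun hxy 0) 0
  have h1 := congrFun (congrFun hxy 0) 1
  simp only [pauli, Matrix.of_apply, Matrix.cons_val', Matrix.cons_val_zero, Matrix.cons_val_one,
    Matrix.cons_val_fin_one, Complex.ofReal_inj] at h0 h1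
  have h2 := congrArg Complex.re h1
  have h3 := congrArg Complex.im h1
  simp at h2 h3
  ext i
  fin_cases i
  · exact h0
  · exact h2
  · exact h3

theorem Implements.eq_one_of_smul_one {c : ℂ} (hc : c ≠ 0) {R : SO3} (h : Implements (c • 1) R) :
    R = 1 := by
  apply Subtype.ext
  apply Matrix.mulVec_injective
  ext1 x
  rw [OneMemClass.coe_one, Matrix.one_mulVec]
  have := h x
  rw [smul_mul_assoc, one_mul, mul_smul_comm, mul_one] at this
  exact (pauli_injective (smul_right_injective _ hc this)).symm

/-- Such an `M` commutes with all Pauli matrices and is therefore scalar; these are the two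
consequences needed. -/
theorem Implements.of_one {M : Matrix (Fin 2) (Fin 2) ℂ} (h : Implements M 1) :
    M 1 0 = 0 ∧ M 0 0 = M 1 1 := by
  have hx := congrFun (congrFun (h ![1, 0, 0]) 1) 0
  have hy := congrFun (congrFun (h ![0, 1, 0]) 0) 1
  simp [pauli, Matrix.mul_apply, Fin.sum_univ_two] at hx hy
  exact ⟨by linear_combination hx / 2, hy⟩

theorem implements_spinor (u : Fin 3 → ℝ) (hu : u ⬝ᵥ u = 1) (θ : ℝ) :
    Implements (spinor u (Complex.exp (θ * Complex.I))) (rotationAbout u hu θ) := by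
  intro x
  have h1 : u 0 * u 0 + u 1 * u 1 + u 2 * u 2 = 1 := by
    simpa [dotProduct, Fin.sum_univ_three] using hu
  have h1' : (u 0 : ℂ) * u 0 + u 1 * u 1 + u 2 * u 2 = 1 := by exact_mod_cast h1
  have h2 := Complex.sin_sq_add_cos_sq (θ : ℂ)
  have hI := Complex.I_sq
  rw [Complex.exp_mul_I]
  clear h1
  ext i j
  fin_cases i <;> fin_cases j <;>
    simp [spinor, pauli, rotationAbout, rotationMatrix, Matrix.mulVec, Matrix.mul_apply, dotProduct,
      Fin.sum_univ_three, Fin.sum_univ_two, Matrix.vecMulVec_apply] <;>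
    generalize Complex.sin (θ : ℂ) = s at * <;>
    generalize Complex.cos (θ : ℂ) = c at * <;>
    generalize (u 0 : ℂ) = a at * <;>
    generalize (u 1 : ℂ) = b at * <;>
    generalize (u 2 : ℂ) = d at * <;>
    generalize (x 0 : ℂ) = X at * <;>
    generalize (x 1 : ℂ) = Y at * <;>
    generalize (x 2 : ℂ) = Z at * <;>
    generalize Complex.I = I at * <;>
    grind

theorem pauli_mul_self (u : Fin 3 → ℝ) (hu : u ⬝ᵥ u = 1) : pauli u * pauli u = 1 := by
  have h1 : u 0 * u 0 + u 1 * u 1 + u 2 * u 2 = 1 := by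
    simpa [dotProduct, Fin.sum_univ_three] using hu
  have h1' : (u 0 : ℂ) * u 0 + u 1 * u 1 + u 2 * u 2 = 1 := by exact_mod_cast h1
  have hI := Complex.I_sq
  ext i j
  fin_cases i <;> fin_cases j <;> simp [pauli, Matrix.mul_apply, Fin.sum_univ_two]
  · linear_combination h1' - (u 2 : ℂ) ^ 2 * hI
  · ring
  · ring
  · linear_combination h1' - (u 2 : ℂ) ^ 2 * hI

/-- `(1 + pauli u)/2` is idempotent. With eigenvalues `ξ, 1` instead of half-angle phases, powers of
a lift carry no sign ambiguity. -/
theorem spinor_mul (u : Fin 3 → ℝ) (hu : u ⬝ᵥ u = 1) (ξ η : ℂ) :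
    spinor u ξ * spinor u η = spinor u (ξ * η) := by
  have h := pauli_mul_self u hu
  have h2 : (1 + pauli u) * (1 + pauli u) = (2 : ℂ) • (1 + pauli u) := by
    rw [two_smul, add_mul, one_mul, mul_add, h, mul_one, add_comm (pauli u) 1]
  unfold spinor
  generalize 1 + pauli u = Q at h2
  rw [add_mul, one_mul, mul_add, mul_one, smul_mul_smul_comm, h2]
  module

theorem spinor_one (u : Fin 3 → ℝ) : spinor u 1 = 1 := by simp [spinor]

theorem spinor_pow (u : Fin 3 → ℝ) (hu : u ⬝ᵥ u = 1) (ξ : ℂ) (k : ℕ) :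
    spinor u ξ ^ k = spinor u (ξ ^ k) := by
  induction k with
  | zero => simp [spinor_one]
  | succ k ih => rw [pow_succ, ih, spinor_mul u hu, pow_succ]

theorem xAxis_unit : (![1, 0, 0] : Fin 3 → ℝ) ⬝ᵥ ![1, 0, 0] = 1 := by simp

theorem spinor_xAxis (ξ : ℂ) : spinor ![1, 0, 0] ξ = !![ξ, 0; 0, 1] := by
  ext i j
  fin_cases i <;> fin_cases j <;> simp [spinor, pauli]

theorem spinor_planeAxis (φ : ℝ) (η : ℂ) :
    spinor (planeAxis φ) η =
      !![1 + (η - 1) * ((1 + Real.cos φ) / 2), (η - 1) * (Real.sin φ / 2);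
        (η - 1) * (Real.sin φ / 2), 1 + (η - 1) * ((1 - Real.cos φ) / 2)] := by
  ext i j
  fin_cases i <;> fin_cases j <;> simp [spinor, pauli, planeAxis] <;> ring

/-- A primitive `k`-th root of unity. -/
noncomputable def expRoot (k : ℕ) : ℂ := Complex.exp ((2 * Real.pi / k : ℝ) * Complex.I)

theorem expRoot_isPrimitiveRoot {k : ℕ} (hk : k ≠ 0) : IsPrimitiveRoot (expRoot k) k := by
  have := Complex.isPrimitiveRoot_exp k hk
  rw [expRoot]
  convert this using 2
  push_cast
  ring

theorem implements_rotA (p : ℕ) : Implements (spinor ![1, 0, 0] (expRoot p)) (rotA p) :=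
  implements_spinor _ _ _

theorem implements_rotB (n m q : ℕ) :
    Implements (spinor (planeAxis (2 * Real.pi * n / m)) (expRoot q)) (rotB n m q) :=
  implements_spinor _ _ _

theorem implements_rotA_pow (p k : ℕ) :
    Implements (spinor ![1, 0, 0] (expRoot p ^ k)) (rotA p ^ k) := by
  rw [← spinor_pow _ xAxis_unit]
  exact (implements_rotA p).pow k

theorem implements_rotB_pow (n m q k : ℕ) :
    Implements (spinor (planeAxis (2 * Real.pi * n / m)) (expRoot q ^ k)) (rotB n m q ^ k) := by
  rw [← spinor_pow _ (planeAxis_unit _)]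
  exact (implements_rotB n m q).pow k

theorem rotA_pow_self {p : ℕ} (hp : 0 < p) : rotA p ^ p = 1 := by
  have h := implements_rotA_pow p p
  rw [(expRoot_isPrimitiveRoot hp.ne').pow_eq_one, spinor_one] at h
  exact Implements.eq_one_of_smul_one one_ne_zero (by rwa [one_smul])

theorem rotB_pow_self (n m : ℕ) {q : ℕ} (hq : 0 < q) : rotB n m q ^ q = 1 := by
  have h := implements_rotB_pow n m q q
  rw [(expRoot_isPrimitiveRoot hq.ne').pow_eq_one, spinor_one] at h
  exact Implements.eq_one_of_smul_one one_ne_zero (by rwa [one_smul])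

theorem dvd_of_rotA_pow_eq_one {p k : ℕ} (hp : 0 < p) (h : rotA p ^ k = 1) : p ∣ k := by
  have h1 := implements_rotA_pow p k
  rw [h, spinor_xAxis] at h1
  exact (expRoot_isPrimitiveRoot hp.ne').dvd_of_pow_eq_one _ (by simpa using h1.of_one.2)

/-! ### Ping-pong and the injectivity criterion. -/

/-- The ping-pong estimate: an alternating word acts on the first basis vector in a controlled way,
in coordinates `(α, β)` with respect to the first basis vector and `(κ, s)`. -/
theorem IsAltWord.exists_implements {Γ : Type*} [LinearOrderedCommGroupWithZero Γ]
    (v : Valuation ℂ Γ) {G : Type*} [Group G] {a b : G} (Φ : G →* SO3) {p q n m h : ℕ}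
    (hp : 0 < p) (hq : 0 < q) (hΦa : Φ a = rotA p) (hΦb : Φ b = rotB n m q) {κ s : ℂ}
    (hκ : κ = (1 + Real.cos (2 * Real.pi * n / m)) / 2) (hs : s = Real.sin (2 * Real.pi * n / m) / 2)
    (hA : ∀ k, ¬ h ∣ k → 1 < v ((expRoot p ^ k - 1) * κ))
    (hB : ∀ k, ¬ q ∣ k → v (expRoot q ^ k - 1) = 1) {st : Bool} {g : G}
    (hg : IsAltWord a b h q st g) :
    ∃ (M : Matrix (Fin 2) (Fin 2) ℂ) (α β : ℂ), Implements M (Φ g) ∧ M 0 0 = α + β * κ ∧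
      M 1 0 = β * s ∧ (st = true → v α ≤ v β ∧ β ≠ 0) ∧ (st = false → v β < v α) := by
  have hξ : ∀ k, v (expRoot p ^ k) = 1 := fun k => by
    rw [map_pow, v.map_eq_one_of_pow_eq_one hp.ne' (expRoot_isPrimitiveRoot hp.ne').pow_eq_one,
      one_pow]
  have hη : ∀ k, v (expRoot q ^ k) = 1 := fun k => by
    rw [map_pow, v.map_eq_one_of_pow_eq_one hq.ne' (expRoot_isPrimitiveRoot hq.ne').pow_eq_one,
      one_pow]
  -- This is the idempotence of `P`: it makes `(κ, s)` an eigenvector of the lift of `B`.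
  have hκs : s * s = κ - κ ^ 2 := by
    have h2 : (Real.sin (2 * Real.pi * n / m) : ℂ) ^ 2 + (Real.cos (2 * Real.pi * n / m) : ℂ) ^ 2
        = 1 := by exact_mod_cast Real.sin_sq_add_cos_sq _
    rw [hs, hκ]
    linear_combination h2 / 4
  have stepA : ∀ (k : ℕ) (w : G) (M : Matrix (Fin 2) (Fin 2) ℂ) (α β : ℂ), Implements M (Φ w) →
      M 0 0 = α + β * κ → M 1 0 = β * s → ∃ M', Implements M' (Φ (a ^ k * w)) ∧
      M' 0 0 = (expRoot p ^ k * α + (expRoot p ^ k - 1) * κ * β) + β * κ ∧ M' 1 0 = β * s := by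
    intro k w M α β hM h0 h1
    refine ⟨_, by rw [map_mul, map_pow, hΦa]; exact (implements_rotA_pow p k).mul hM, ?_, ?_⟩
    · simp [spinor_xAxis, Matrix.mul_apply, Fin.sum_univ_two, h0]
      ring
    · simp [spinor_xAxis, Matrix.mul_apply, Fin.sum_univ_two, h1]
  have stepB : ∀ (k : ℕ) (w : G) (M : Matrix (Fin 2) (Fin 2) ℂ) (α β : ℂ), Implements M (Φ w) →
      M 0 0 = α + β * κ → M 1 0 = β * s → ∃ M', Implements M' (Φ (b ^ k * w)) ∧
      M' 0 0 = α + (expRoot q ^ k * β + (expRoot q ^ k - 1) * α) * κ ∧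
      M' 1 0 = (expRoot q ^ k * β + (expRoot q ^ k - 1) * α) * s := by
    intro k w M α β hM h0 h1
    have hκ' : (1 - (Real.cos (2 * Real.pi * n / m) : ℂ)) / 2 = 1 - κ := by rw [hκ]; ring
    refine ⟨_, by rw [map_mul, map_pow, hΦb]; exact (implements_rotB_pow n m q k).mul hM, ?_, ?_⟩
    · rw [spinor_planeAxis, ← hκ, ← hs, hκ', Matrix.mul_apply, Fin.sum_univ_two, h0, h1]
      simp only [Matrix.of_apply, Matrix.cons_val', Matrix.cons_val_zero, Matrix.cons_val_one,
        Matrix.cons_val_fin_one]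
      linear_combination (expRoot q ^ k - 1) * β * hκs
    · rw [spinor_planeAxis, ← hκ, ← hs, hκ', Matrix.mul_apply, Fin.sum_univ_two, h0, h1]
      simp only [Matrix.of_apply, Matrix.cons_val', Matrix.cons_val_zero, Matrix.cons_val_one,
        Matrix.cons_val_fin_one]
      ring
  have valA : ∀ {k : ℕ} {α β : ℂ}, ¬ h ∣ k → v α ≤ v β → β ≠ 0 →
      v β < v (expRoot p ^ k * α + (expRoot p ^ k - 1) * κ * β) := by
    intro k α β hk hle hβ
    have h1 : v β < v ((expRoot p ^ k - 1) * κ * β) := by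
      rw [map_mul]
      exact lt_mul_of_one_lt_left (zero_lt_iff.2 ((Valuation.ne_zero_iff v).2 hβ)) (hA k hk)
    rwa [v.map_add_eq_of_lt_right]
    rw [map_mul, hξ, one_mul]
    exact hle.trans_lt h1
  have valB : ∀ {k : ℕ} {α β : ℂ}, ¬ q ∣ k → v β < v α →
      v (expRoot q ^ k * β + (expRoot q ^ k - 1) * α) = v α := by
    intro k α β hk hlt
    have h1 : v ((expRoot q ^ k - 1) * α) = v α := by rw [map_mul, hB k hk, one_mul]
    rw [v.map_add_eq_of_lt_right, h1]
    rwa [h1, map_mul, hη, one_mul]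
  have start : Implements 1 (Φ 1) := by rw [map_one]; exact implements_one
  induction hg with
  | @left_pow k hk =>
    obtain ⟨M, hM, h0, h1⟩ := stepA k 1 1 1 0 start (by simp) (by simp)
    rw [mul_one] at hM
    exact ⟨M, _, _, hM, h0, h1, by simp, fun _ => by simp [hξ]⟩
  | @left_mul k w hk hw ih =>
    obtain ⟨N, α, β, hN, h0, h1, hst, -⟩ := ih
    obtain ⟨M, hM, h0, h1⟩ := stepA k w N α β hN h0 h1
    exact ⟨M, _, _, hM, h0, h1, by simp, fun _ => valA hk (hst rfl).1 (hst rfl).2⟩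
  | @right_pow k hk =>
    obtain ⟨M, hM, h0, h1⟩ := stepB k 1 1 1 0 start (by simp) (by simp)
    rw [mul_one] at hM
    have hv := valB (α := 1) (β := 0) hk (by simp)
    exact ⟨M, _, _, hM, h0, h1, fun _ => ⟨hv.ge, fun h0 => by rw [h0] at hv; simp at hv⟩, by simp⟩
  | @right_mul k w hk hw ih =>
    obtain ⟨N, α, β, hN, h0, h1, -, hst⟩ := ih
    obtain ⟨M, hM, h0, h1⟩ := stepB k w N α β hN h0 h1
    have hlt := hst rfl
    have hv := valB hk hlt
    refine ⟨M, _, _, hM, h0, h1, fun _ => ⟨hv.ge, fun h0 => ?_⟩, by simp⟩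
    rw [h0, map_zero] at hv
    exact absurd hlt (by simp [← hv])

/-- A group on two generators with enough relations to reach the normal form is isomorphic to
`rotGroup n m p q` as soon as the ping-pong estimates hold. -/
theorem exists_mulEquiv_rotGroup {Γ : Type*} [LinearOrderedCommGroupWithZero Γ]
    (v : Valuation ℂ Γ) {G : Type*} [Group G] {a b : G} (Φ : G →* SO3) {p q n m h e : ℕ}
    (hp : 0 < p) (hq : 0 < q) (hΦa : Φ a = rotA p) (hΦb : Φ b = rotB n m q)
    (hs : Real.sin (2 * Real.pi * n / m) ≠ 0)
    (hA : ∀ k, ¬ h ∣ k → 1 < v ((expRoot p ^ k - 1) * ((1 + Real.cos (2 * Real.pi * n / m)) / 2)))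
    (hB : ∀ k, ¬ q ∣ k → v (expRoot q ^ k - 1) = 1)
    (hgen : Subgroup.closure {a, b} = ⊤) (ha : a ^ p = 1) (hb : b ^ q = 1)
    (hab : b * a ^ h = a ^ h * b ^ e) :
    ∃ f : G ≃* rotGroup n m p q, ∀ g, (f g : SO3) = Φ g := by
  have hinj : Function.Injective Φ := by
    rw [injective_iff_map_eq_one]
    intro g hg
    obtain ⟨k, w, rfl, rfl | hw⟩ := hasNormalForm_of_closure_eq_top hp hq hgen ha hb hab g
    · rw [mul_one] at hg ⊢
      rw [map_pow, hΦa] at hg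
      exact pow_eq_one_of_dvd ha (dvd_of_rotA_pow_eq_one hp hg)
    · obtain ⟨M, α, β, hM, -, h1, hst, -⟩ :=
        hw.exists_implements v Φ hp hq hΦa hΦb rfl rfl hA hB
      -- Left multiplication by `diag(ξ^k, 1)` leaves the lower left entry `βs` unchanged, so the
      -- prefix `a^k` is harmless.
      have hM' := (implements_rotA_pow p k).mul hM
      rw [← hΦa, ← map_pow, ← map_mul, hg] at hM'
      have h10 := hM'.of_one.1
      rw [spinor_xAxis, Matrix.mul_apply, Fin.sum_univ_two, h1] at h10
      simp only [Matrix.of_apply, Matrix.cons_val', Matrix.cons_val_zero, Matrix.cons_val_one,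
        Matrix.cons_val_fin_one, zero_mul, zero_add, one_mul] at h10
      refine absurd h10 (mul_ne_zero (hst rfl).2 (div_ne_zero ?_ two_ne_zero))
      exact_mod_cast hs
  have hrange : Φ.range = rotGroup n m p q := by
    rw [MonoidHom.range_eq_map, ← hgen, MonoidHom.map_closure, Set.image_pair, hΦa, hΦb, rotGroup]
  exact ⟨(MonoidHom.ofInjective hinj).trans (MulEquiv.subgroupCongr hrange), fun g => rfl⟩

/-! ### The valuation of `(1 + cos φ)/2`. -/

section AxisRoot

/-- `exp (2πi n / m)`. -/
noncomputable def axisRoot (n m : ℕ) : ℂ :=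
  Complex.exp ((2 * Real.pi * n / m : ℝ) * Complex.I)

variable {n m : ℕ}

theorem axisRoot_eq_pow : axisRoot n m = expRoot m ^ n := by
  rw [axisRoot, expRoot, ← Complex.exp_nat_mul]
  congr 1
  push_cast
  ring

theorem axisRoot_eq : axisRoot n m = (Real.cos (2 * Real.pi * n / m) : ℂ) +
    Real.sin (2 * Real.pi * n / m) * Complex.I := by
  rw [axisRoot, Complex.exp_mul_I, Complex.ofReal_cos, Complex.ofReal_sin]

theorem axisRoot_isPrimitiveRoot (hm : m ≠ 0) (hnm : Nat.Coprime n m) :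
    IsPrimitiveRoot (axisRoot n m) m := by
  rw [axisRoot_eq_pow]
  exact (expRoot_isPrimitiveRoot hm).pow_of_coprime n hnm

/-- This is `w + w⁻¹ = 2 cos φ` multiplied out; it turns the size of `κ` into that of `z - 1` for
the root of unity `z = -w`. -/
theorem one_add_axisRoot_sq : (1 + axisRoot n m) ^ 2 =
    ((1 + Real.cos (2 * Real.pi * n / m) : ℂ) / 2) * 2 ^ 2 * axisRoot n m := by
  have h : (Real.sin (2 * Real.pi * n / m) : ℂ) ^ 2 + (Real.cos (2 * Real.pi * n / m) : ℂ) ^ 2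
      = 1 := by exact_mod_cast Real.sin_sq_add_cos_sq _
  rw [axisRoot_eq]
  linear_combination (Real.sin (2 * Real.pi * n / m) : ℂ) ^ 2 * Complex.I_sq - h

theorem sin_axis_ne_zero (hm : 2 < m) (hnm : Nat.Coprime n m) :
    Real.sin (2 * Real.pi * n / m) ≠ 0 := by
  intro h
  have h2 : (Real.cos (2 * Real.pi * n / m) : ℂ) ^ 2 = 1 := by
    have := Real.sin_sq_add_cos_sq (2 * Real.pi * n / m)
    rw [h] at this
    exact_mod_cast (by linarith : Real.cos (2 * Real.pi * n / m) ^ 2 = 1)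
  have h3 : axisRoot n m ^ 2 = 1 := by rw [axisRoot_eq, h]; simpa using h2
  exact absurd (Nat.le_of_dvd two_pos
    ((axisRoot_isPrimitiveRoot (by omega) hnm).dvd_of_pow_eq_one _ h3)) (by omega)

theorem cos_axis_eq_zero (hn4 : Nat.Coprime n 4) : Real.cos (2 * Real.pi * n / (4 : ℕ)) = 0 := by
  rw [Real.cos_eq_zero_iff]
  have hodd : Odd n := by
    rw [← Nat.coprime_two_right]
    exact hn4.coprime_dvd_right (by norm_num)
  obtain ⟨k, rfl⟩ := hodd
  exact ⟨k, by push_cast; ring⟩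

variable {Γ : Type*} [LinearOrderedCommGroupWithZero Γ] (v : Valuation ℂ Γ)

theorem map_neg_axisRoot_sub_one_sq (hm : m ≠ 0) (hnm : Nat.Coprime n m) :
    v (-axisRoot n m - 1) ^ 2 = v ((1 + Real.cos (2 * Real.pi * n / m)) / 2) * v 2 ^ 2 := by
  have hw : v (axisRoot n m) = 1 :=
    v.map_eq_one_of_pow_eq_one hm (axisRoot_isPrimitiveRoot hm hnm).pow_eq_one
  rw [← map_pow, show (-axisRoot n m - 1) ^ 2 = (1 + axisRoot n m) ^ 2 by ring,
    one_add_axisRoot_sq, map_mul, map_mul, hw, mul_one, map_pow]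

theorem neg_axisRoot_pow (hm : m ≠ 0) (hnm : Nat.Coprime n m) :
    (-axisRoot n m) ^ (2 * m) = 1 := by
  rw [pow_mul, neg_sq, ← pow_mul, mul_comm, pow_mul,
    (axisRoot_isPrimitiveRoot hm hnm).pow_eq_one, one_pow]

theorem one_lt_map_axis (h2 : v 2 < 1) (hm : 2 < m) (hnm : Nat.Coprime n m) :
    1 < v ((1 + Real.cos (2 * Real.pi * n / m)) / 2) := by
  have hprim := axisRoot_isPrimitiveRoot (n := n) (m := m) (by omega) hnm
  have hsq : axisRoot n m ^ 2 ≠ 1 := fun h => by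
    exact absurd (Nat.le_of_dvd two_pos (hprim.dvd_of_pow_eq_one _ h)) (by omega)
  have hlt : v 2 < v (-axisRoot n m - 1) := by
    refine v.two_lt_map_sub_one h2 (by omega) (neg_axisRoot_pow (by omega) hnm) ?_ ?_
    · intro h; exact hsq (by rw [← neg_sq, h, one_pow])
    · intro h; exact hsq (by rw [← neg_sq, h]; norm_num)
  have h := pow_lt_pow_left₀ hlt zero_le two_ne_zero
  rw [map_neg_axisRoot_sub_one_sq v (by omega) hnm] at h
  exact lt_of_mul_lt_mul_right (a := v 2 ^ 2) (by rwa [one_mul]) zero_le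

theorem one_lt_two_mul_map_axis (h2 : v 2 < 1) (hm : 2 < m) (hm4 : m ≠ 4)
    (hnm : Nat.Coprime n m) : 1 < v 2 * v ((1 + Real.cos (2 * Real.pi * n / m)) / 2) := by
  have hprim := axisRoot_isPrimitiveRoot (n := n) (m := m) (by omega) hnm
  have hfour : (-axisRoot n m) ^ 4 ≠ 1 := fun h => by
    rw [Even.neg_pow (by decide)] at h
    have hd := hprim.dvd_of_pow_eq_one _ h
    have := Nat.le_of_dvd four_pos hd
    interval_cases m <;> omega
  have h := v.two_lt_map_sub_one_sq h2 (by omega) (neg_axisRoot_pow (by omega) hnm) hfour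
  rw [map_neg_axisRoot_sub_one_sq v (by omega) hnm] at h
  refine lt_of_mul_lt_mul_right (a := v 2) ?_ zero_le
  rwa [one_mul, mul_comm (v 2), mul_assoc, ← sq]

end AxisRoot

/-! ### The estimates in the free and the amalgamated case. -/

theorem expRoot_pow_ne_one {p k : ℕ} (hp : 0 < p) (hk : ¬ p ∣ k) : expRoot p ^ k ≠ 1 := fun h =>
  hk ((expRoot_isPrimitiveRoot hp.ne').dvd_of_pow_eq_one _ h)

theorem expRoot_pow_pow {p : ℕ} (hp : 0 < p) (k : ℕ) : (expRoot p ^ k) ^ p = 1 := by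
  rw [← pow_mul, mul_comm, pow_mul, (expRoot_isPrimitiveRoot hp.ne').pow_eq_one, one_pow]

theorem map_expRoot_pow_sub_one {Γ : Type*} [LinearOrderedCommGroupWithZero Γ]
    (v : Valuation ℂ Γ) (h2 : v 2 < 1) {q k : ℕ} (hq : Odd q) (hk : ¬ q ∣ k) :
    v (expRoot q ^ k - 1) = 1 :=
  v.map_sub_one_of_odd_pow h2 hq (expRoot_pow_pow hq.pos k) (expRoot_pow_ne_one hq.pos hk)

theorem mul_mul_eq_inv_of_mul_sq {G : Type*} [Group G] {t b : G} (h : (t * b) ^ 2 = 1) :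
    t * b * t = b⁻¹ :=
  eq_inv_of_mul_eq_one_left (by rwa [sq, ← mul_assoc] at h)

/-- The free product case. -/
theorem exists_mulEquiv_rotGroup_of_pow {G : Type*} [Group G] {a b : G} (Φ : G →* SO3)
    {p q n m : ℕ} (hp : 0 < p) (hΦa : Φ a = rotA p) (hΦb : Φ b = rotB n m q) (hm : 2 < m)
    (hnm : Nat.Coprime n m) (hq : Odd q) (hpm : Odd p ∨ m ≠ 4)
    (hgen : Subgroup.closure {a, b} = ⊤) (ha : a ^ p = 1) (hb : b ^ q = 1) :
    ∃ f : G ≃* rotGroup n m p q, ∀ g, (f g : SO3) = Φ g := by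
  obtain ⟨V, h2⟩ := exists_valuationSubring_two_lt_one
  -- With `h = p` the commutation relation is trivial, because `a^p = 1`.
  refine exists_mulEquiv_rotGroup V.valuation Φ (h := p) (e := 1) hp hq.pos hΦa hΦb
    (sin_axis_ne_zero hm hnm) (fun k hk => ?_)
    (fun k hk => map_expRoot_pow_sub_one _ h2 hq hk) hgen ha hb (by simp [ha])
  rw [map_mul]
  rcases hpm with hodd | hm4
  · rw [map_expRoot_pow_sub_one _ h2 hodd hk, one_mul]
    exact one_lt_map_axis _ h2 hm hnm
  · exact (one_lt_two_mul_map_axis _ h2 hm hm4 hnm).trans_le (mul_le_mul_left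
      (Valuation.two_le_map_sub_one _ h2 hp.ne' (expRoot_pow_pow hp k) (expRoot_pow_ne_one hp hk)) _)

/-- The amalgamated case. -/
theorem exists_mulEquiv_rotGroup_of_half_pow {G : Type*} [Group G] {a b : G} (Φ : G →* SO3)
    {p q n : ℕ} (hp : 0 < p) (hpe : Even p) (hΦa : Φ a = rotA p) (hΦb : Φ b = rotB n 4 q)
    (hn4 : Nat.Coprime n 4) (hq : Odd q)
    (hgen : Subgroup.closure {a, b} = ⊤) (ha : a ^ p = 1) (hb : b ^ q = 1)
    (hab : (a ^ (p / 2) * b) ^ 2 = 1) :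
    ∃ f : G ≃* rotGroup n 4 p q, ∀ g, (f g : SO3) = Φ g := by
  obtain ⟨V, h2⟩ := exists_valuationSubring_two_lt_one
  have hhalf : p / 2 * 2 = p := Nat.div_mul_cancel hpe.two_dvd
  -- The involution `a^(p/2)` inverts `b`, and `b^(q - 1)` is `b⁻¹` as a natural power.
  refine exists_mulEquiv_rotGroup V.valuation Φ (h := p / 2) (e := q - 1) hp hq.pos hΦa hΦb
    (sin_axis_ne_zero (by norm_num) hn4) (fun k hk => ?_)
    (fun k hk => map_expRoot_pow_sub_one _ h2 hq hk) hgen ha hb ?_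
  · rw [map_mul]
    have hne : expRoot p ^ k ≠ -1 := fun h => by
      refine expRoot_pow_ne_one (k := k * 2) hp (fun hd => hk ?_) (by rw [pow_mul, h]; norm_num)
      rw [← hhalf] at hd
      exact Nat.dvd_of_mul_dvd_mul_right two_pos hd
    have hlt := V.valuation.two_lt_map_sub_one h2 hp.ne' (expRoot_pow_pow hp k)
      (expRoot_pow_ne_one hp fun hd => hk ((Dvd.intro _ hhalf).trans hd)) hne
    have h0 : V.valuation 2 ≠ 0 := (Valuation.ne_zero_iff _).2 two_ne_zero
    -- Here `κ = 1/2`, so the required estimate is exactly `v 2 < v (ξ^k - 1)`.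
    rw [cos_axis_eq_zero hn4, Complex.ofReal_zero, add_zero, map_div₀, map_one, ← div_eq_mul_one_div,
      one_lt_div₀ (zero_lt_iff.2 h0)]
    exact hlt
  · have hτ : a ^ (p / 2) * a ^ (p / 2) = 1 := by rw [← sq, ← pow_mul, hhalf, ha]
    have hbq : b * b ^ (q - 1) = 1 := by rw [← pow_succ', Nat.sub_add_cancel hq.pos, hb]
    rw [eq_inv_of_mul_eq_one_right hbq, ← mul_mul_eq_inv_of_mul_sq hab, ← mul_assoc, ← mul_assoc,
      hτ, one_mul]

theorem rotA_half_mul_rotB_sq {p q n : ℕ} (hp : 0 < p) (hpe : Even p) (hn4 : Nat.Coprime n 4) :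
    (rotA p ^ (p / 2) * rotB n 4 q) ^ 2 = 1 := by
  have hhalf : p / 2 * 2 = p := Nat.div_mul_cancel hpe.two_dvd
  have hξ : expRoot p ^ (p / 2) = -1 := by
    have h1 : (expRoot p ^ (p / 2)) ^ 2 = 1 := by
      rw [← pow_mul, hhalf, (expRoot_isPrimitiveRoot hp.ne').pow_eq_one]
    refine (sq_eq_sq_iff_eq_or_eq_neg.1 (h1.trans (one_pow 2).symm)).resolve_left
      (expRoot_pow_ne_one hp fun hd => ?_)
    exact absurd (Nat.le_of_dvd (by omega) hd) (by omega)
  have h := ((implements_rotA_pow p (p / 2)).mul (implements_rotB n 4 q)).pow 2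
  -- The lift of `A^(p/2) B` has trace `0` and determinant `-η`, so its square is the scalar `η`.
  refine Implements.eq_one_of_smul_one (c := expRoot q) (Complex.exp_ne_zero _) ?_
  convert h using 1
  have hs : (Real.sin (2 * Real.pi * n / (4 : ℕ)) : ℂ) ^ 2 = 1 := by
    have := Real.sin_sq_add_cos_sq (2 * Real.pi * n / (4 : ℕ))
    rw [cos_axis_eq_zero hn4] at this
    exact_mod_cast (by linarith : Real.sin (2 * Real.pi * n / (4 : ℕ)) ^ 2 = 1)
  rw [hξ, spinor_xAxis, spinor_planeAxis, cos_axis_eq_zero hn4]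
  generalize (Real.sin (2 * Real.pi * n / (4 : ℕ)) : ℂ) = s at hs
  ext i j
  fin_cases i <;> fin_cases j <;> simp [sq, Matrix.mul_apply, Fin.sum_univ_two]
  · linear_combination (expRoot q - 1) ^ 2 / 4 * hs
  · ring
  · ring
  · linear_combination (expRoot q - 1) ^ 2 / 4 * hs

/-! ### Homomorphisms out of cyclic and dihedral groups. -/

section Lifts

variable {K : Type*} [Group K]

/-- The homomorphism from `Cyc k` that sends the standard generator to `x`. -/
def cycLift (k : ℕ) [NeZero k] (x : K) (hx : x ^ k = 1) : Cyc k →* K where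
  toFun i := x ^ (Multiplicative.toAdd i).val
  map_one' := by simp
  map_mul' i j := by rw [← pow_add, toAdd_mul, ZMod.val_add, ← pow_eq_pow_mod _ hx]

theorem cycLift_cycGen (k : ℕ) [NeZero k] (x : K) (hx : x ^ k = 1) :
    cycLift k x hx (cycGen k) = x := by
  change x ^ (1 : ZMod k).val = x
  rw [ZMod.val_one_eq_one_mod, ← pow_eq_pow_mod _ hx, pow_one]

theorem eq_cycGen_pow (k : ℕ) [NeZero k] (x : Cyc k) :
    x = cycGen k ^ (Multiplicative.toAdd x).val := by
  rw [cycGen, ← ofAdd_nsmul]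
  simp

theorem cycGen_pow_self (k : ℕ) : cycGen k ^ k = 1 := by
  rw [cycGen, ← ofAdd_nsmul]
  simp

/-- The homomorphism from the dihedral group that sends `r 1` to `b` and `sr 0` to `t`. -/
def dihedralLift (q : ℕ) [NeZero q] (t b : K) (ht : t * t = 1) (hb : b ^ q = 1)
    (htb : t * b * t = b⁻¹) : DihedralGroup q →* K :=
  have conj : ∀ i : ZMod q, cycLift q b hb (Multiplicative.ofAdd i) * t =
      t * cycLift q b hb (Multiplicative.ofAdd (-i)) := fun i => by
    have ht' : t⁻¹ = t := inv_eq_of_mul_eq_one_left ht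
    have h : t * cycLift q b hb (Multiplicative.ofAdd i) * t =
        (cycLift q b hb (Multiplicative.ofAdd i))⁻¹ := by
      change t * b ^ _ * t = (b ^ _)⁻¹
      nth_rw 2 [← ht']
      rw [← conj_pow, ht', htb, inv_pow]
    rw [ofAdd_neg, map_inv, ← h, ← mul_assoc, ← mul_assoc, ht, one_mul]
  { toFun := fun
      | .r i => cycLift q b hb (Multiplicative.ofAdd i)
      | .sr i => t * cycLift q b hb (Multiplicative.ofAdd i)
    map_one' := map_one (cycLift q b hb)
    map_mul' := by
      rintro (i | i) (j | j)
      · exact map_mul _ _ _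
      · change t * cycLift q b hb (Multiplicative.ofAdd (j - i)) = _
        rw [← mul_assoc, conj, mul_assoc, ← map_mul, ← ofAdd_add, neg_add_eq_sub]
      · change t * cycLift q b hb (Multiplicative.ofAdd (i + j)) = _
        rw [mul_assoc, ← map_mul, ← ofAdd_add]
      · change cycLift q b hb (Multiplicative.ofAdd (j - i)) = _
        rw [mul_assoc, ← mul_assoc _ t, conj, ← mul_assoc, ← mul_assoc, ht, one_mul, ← map_mul,
          ← ofAdd_add, neg_add_eq_sub] }

theorem dihedralLift_r_one (q : ℕ) [NeZero q] (t b : K) (ht : t * t = 1) (hb : b ^ q = 1)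
    (htb : t * b * t = b⁻¹) : dihedralLift q t b ht hb htb (DihedralGroup.r 1) = b :=
  cycLift_cycGen q b hb

theorem dihedralLift_sr_zero (q : ℕ) [NeZero q] (t b : K) (ht : t * t = 1) (hb : b ^ q = 1)
    (htb : t * b * t = b⁻¹) : dihedralLift q t b ht hb htb (DihedralGroup.sr 0) = t := by
  change t * cycLift q b hb 1 = t
  rw [map_one, mul_one]

end Lifts

/-! ### The presented groups and the free product. -/

theorem closure_presentedGroup_of (rels : Set (FreeGroup (Fin 2))) :
    Subgroup.closure {(PresentedGroup.of 0 : PresentedGroup rels), PresentedGroup.of 1} = ⊤ := by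
  rw [← PresentedGroup.closure_range_of rels]
  congr 1
  ext x
  simp [Fin.exists_fin_two, eq_comm]

theorem PresentedGroup.mk_rel_eq_one {α : Type*} {rels : Set (FreeGroup α)} {r : FreeGroup α}
    (hr : r ∈ rels) : PresentedGroup.mk rels r = 1 :=
  (QuotientGroup.eq_one_iff r).2 (Subgroup.subset_normalClosure hr)

theorem exists_presentedGroup_mulEquiv {p q n m : ℕ} (hp : 0 < p) (hq : Odd q) (hm : 2 < m)
    (hnm : Nat.Coprime n m) (hpm : Odd p ∨ m ≠ 4) :
    ∃ e : PresentedGroup (freeProductRels p q) ≃* rotGroup n m p q,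
      (e (PresentedGroup.of 0) : SO3) = rotA p ∧
      (e (PresentedGroup.of 1) : SO3) = rotB n m q := by
  have hrels : ∀ r ∈ freeProductRels p q, FreeGroup.lift ![rotA p, rotB n m q] r = 1 := by
    rintro r (rfl | rfl)
    · simpa using rotA_pow_self hp
    · simpa using rotB_pow_self n m hq.pos
  have h0 : PresentedGroup.toGroup hrels (PresentedGroup.of 0) = rotA p := by simp
  have h1 : PresentedGroup.toGroup hrels (PresentedGroup.of 1) = rotB n m q := by simp
  obtain ⟨f, hf⟩ := exists_mulEquiv_rotGroup_of_pow (PresentedGroup.toGroup hrels) hp h0 h1 hm hnm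
    hq hpm (closure_presentedGroup_of _)
    (PresentedGroup.mk_rel_eq_one (r := FreeGroup.of 0 ^ p) (.inl rfl))
    (PresentedGroup.mk_rel_eq_one (r := FreeGroup.of 1 ^ q) (.inr rfl))
  exact ⟨f, by rw [hf, h0], by rw [hf, h1]⟩

theorem closure_coprod_cyc (p q : ℕ) [NeZero p] [NeZero q] :
    Subgroup.closure {(Monoid.Coprod.inl (cycGen p) : Monoid.Coprod (Cyc p) (Cyc q)),
      Monoid.Coprod.inr (cycGen q)} = ⊤ := by
  rw [eq_top_iff]
  rintro x -
  induction x using Monoid.Coprod.induction_on with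
  | inl y =>
    rw [eq_cycGen_pow p y, map_pow]
    exact pow_mem (Subgroup.subset_closure (by simp)) _
  | inr y =>
    rw [eq_cycGen_pow q y, map_pow]
    exact pow_mem (Subgroup.subset_closure (by simp)) _
  | mul x y hx hy => exact mul_mem hx hy

theorem exists_coprod_mulEquiv {p q n m : ℕ} (hp : 0 < p) (hq : Odd q) (hm : 2 < m)
    (hnm : Nat.Coprime n m) (hpm : Odd p ∨ m ≠ 4) :
    ∃ e : Monoid.Coprod (Cyc p) (Cyc q) ≃* rotGroup n m p q,
      (e (Monoid.Coprod.inl (cycGen p)) : SO3) = rotA p ∧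
      (e (Monoid.Coprod.inr (cycGen q)) : SO3) = rotB n m q := by
  have : NeZero p := ⟨hp.ne'⟩
  have : NeZero q := ⟨hq.pos.ne'⟩
  let Φ : Monoid.Coprod (Cyc p) (Cyc q) →* SO3 :=
    Monoid.Coprod.lift (cycLift p (rotA p) (rotA_pow_self hp))
      (cycLift q (rotB n m q) (rotB_pow_self n m hq.pos))
  have h0 : Φ (Monoid.Coprod.inl (cycGen p)) = rotA p := by simp [Φ, cycLift_cycGen]
  have h1 : Φ (Monoid.Coprod.inr (cycGen q)) = rotB n m q := by simp [Φ, cycLift_cycGen]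
  obtain ⟨f, hf⟩ := exists_mulEquiv_rotGroup_of_pow Φ hp h0 h1 hm hnm hq hpm
    (closure_coprod_cyc p q) (by rw [← map_pow, cycGen_pow_self, map_one])
    (by rw [← map_pow, cycGen_pow_self, map_one])
  exact ⟨f, by rw [hf, h0], by rw [hf, h1]⟩

theorem exists_presentedGroup_amalgam_mulEquiv {p q n : ℕ} (hp : 0 < p) (hpe : Even p)
    (hq : Odd q) (hn4 : Nat.Coprime n 4) :
    ∃ e : PresentedGroup (amalgamRels p q) ≃* rotGroup n 4 p q,
      (e (PresentedGroup.of 0) : SO3) = rotA p ∧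
      (e (PresentedGroup.of 1) : SO3) = rotB n 4 q := by
  have hrels : ∀ r ∈ amalgamRels p q, FreeGroup.lift ![rotA p, rotB n 4 q] r = 1 := by
    rintro r (rfl | rfl | rfl)
    · simpa using rotA_pow_self hp
    · simpa using rotB_pow_self n 4 hq.pos
    · simpa using rotA_half_mul_rotB_sq hp hpe hn4
  have h0 : PresentedGroup.toGroup hrels (PresentedGroup.of 0) = rotA p := by simp
  have h1 : PresentedGroup.toGroup hrels (PresentedGroup.of 1) = rotB n 4 q := by simp
  obtain ⟨f, hf⟩ := exists_mulEquiv_rotGroup_of_half_pow (PresentedGroup.toGroup hrels) hp hpe h0 h1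
    hn4 hq (closure_presentedGroup_of _)
    (PresentedGroup.mk_rel_eq_one (r := FreeGroup.of 0 ^ p) (.inl rfl))
    (PresentedGroup.mk_rel_eq_one (r := FreeGroup.of 1 ^ q) (.inr (.inl rfl)))
    (PresentedGroup.mk_rel_eq_one (r := (FreeGroup.of 0 ^ (p / 2) * FreeGroup.of 1) ^ 2)
      (.inr (.inr rfl)))
  exact ⟨f, by rw [hf, h0], by rw [hf, h1]⟩

/-! ### The amalgamated product. -/

theorem involutionHom_injective {K : Type} [Group K] (g : K) (hg : g ^ 2 = 1) (hne : g ≠ 1) :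
    Function.Injective (involutionHom g hg) := by
  rw [injective_iff_map_eq_one]
  intro x hx
  change g ^ (Multiplicative.toAdd x).val = 1 at hx
  by_contra hx1
  have hval : (Multiplicative.toAdd x).val = 1 := by
    have h0 : (Multiplicative.toAdd x).val ≠ 0 := fun h => hx1 ((ZMod.val_eq_zero _).1 h)
    have h2 : (Multiplicative.toAdd x).val < 2 := ZMod.val_lt (n := 2) _
    omega
  rw [hval, pow_one] at hx
  exact hne hx

/-- This makes the pushout a genuine amalgamated product over a common subgroup of order two. -/
theorem amalgamMap_injective {p q : ℕ} (hp : 0 < p) (hpe : Even p) :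
    ∀ i, Function.Injective (amalgamMap p q hpe i)
  | false => involutionHom_injective (K := Cyc p) _ (cycGen_half_sq p hpe) fun h => by
    rw [cycGen, ← ofAdd_nsmul, ofAdd_eq_one, nsmul_one, ZMod.natCast_eq_zero_iff] at h
    obtain ⟨c, rfl⟩ := hpe
    exact absurd (Nat.le_of_dvd (by omega) h) (by omega)
  | true => involutionHom_injective (K := DihedralGroup q) _
      (by rw [sq, DihedralGroup.sr_mul_self]) fun h => by
    rw [DihedralGroup.one_def] at h
    exact DihedralGroup.noConfusion rfl (heq_of_eq h)

theorem amalgam_sr_zero (p q : ℕ) (hpe : Even p) :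
    Amalgam.ofDihedral p q hpe (DihedralGroup.sr 0) =
      Amalgam.ofCyc p q hpe (cycGen p) ^ (p / 2) := by
  have h := (Monoid.PushoutI.of_apply_eq_base (amalgamMap p q hpe) true (cycGen 2)).trans
    (Monoid.PushoutI.of_apply_eq_base (amalgamMap p q hpe) false (cycGen 2)).symm
  have ht : amalgamMap p q hpe true (cycGen 2) = DihedralGroup.sr 0 :=
    pow_one (M := DihedralGroup q) _
  have hf : amalgamMap p q hpe false (cycGen 2) = (cycGen p ^ (p / 2) : Cyc p) :=
    pow_one (M := Cyc p) _
  rw [ht, hf] at h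
  rw [← map_pow]
  exact h

/-- The reflection `sr 0` needs no generator of its own, being identified with the `p/2`-th power of
the cyclic one. -/
theorem closure_amalgam (p q : ℕ) [NeZero p] [NeZero q] (hpe : Even p) :
    Subgroup.closure {Amalgam.ofCyc p q hpe (cycGen p),
      Amalgam.ofDihedral p q hpe (DihedralGroup.r 1)} = ⊤ := by
  set H := Subgroup.closure {Amalgam.ofCyc p q hpe (cycGen p),
      Amalgam.ofDihedral p q hpe (DihedralGroup.r 1)} with hH
  have ha : Amalgam.ofCyc p q hpe (cycGen p) ∈ H := Subgroup.subset_closure (by simp)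
  have hb : Amalgam.ofDihedral p q hpe (DihedralGroup.r 1) ∈ H := Subgroup.subset_closure (by simp)
  have hcyc : ∀ g : Cyc p, Amalgam.ofCyc p q hpe g ∈ H := fun g => by
    rw [eq_cycGen_pow p g, map_pow]
    exact pow_mem ha _
  have hr : ∀ i : ZMod q, Amalgam.ofDihedral p q hpe (DihedralGroup.r i) ∈ H := fun i => by
    have h : DihedralGroup.r i = DihedralGroup.r 1 ^ i.val := by simp
    rw [h, map_pow]
    exact pow_mem hb _
  have hdih : ∀ g : DihedralGroup q, Amalgam.ofDihedral p q hpe g ∈ H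
    | .r i => hr i
    | .sr i => by
      have h : DihedralGroup.sr i = DihedralGroup.sr 0 * DihedralGroup.r i := by simp
      rw [h, map_mul, amalgam_sr_zero]
      exact mul_mem (pow_mem ha _) (hr i)
  have hof : ∀ (i : Bool) (g : Factor p q i),
      Monoid.PushoutI.of (φ := amalgamMap p q hpe) i g ∈ H
    | false, g => hcyc g
    | true, g => hdih g
  rw [eq_top_iff]
  rintro x -
  induction x using Monoid.PushoutI.induction_on with
  | of i g => exact hof i g
  | base y => rw [← Monoid.PushoutI.of_apply_eq_base _ false]; exact hof _ _
  | mul x y hx hy => exact mul_mem hx hy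

/-- The homomorphism from the amalgam that sends the generator of `Cyc p` to `a`, the rotation
`r 1` to `b` and the reflection `sr 0` to `a ^ (p / 2)`. -/
def amalgamLift {K : Type*} [Group K] (p q : ℕ) [NeZero p] [NeZero q] (hpe : Even p) (a b : K)
    (ha : a ^ p = 1) (hb : b ^ q = 1) (ht : a ^ (p / 2) * a ^ (p / 2) = 1)
    (hab : a ^ (p / 2) * b * a ^ (p / 2) = b⁻¹) : Amalgam p q hpe →* K :=
  Monoid.PushoutI.lift
    (fun
      | false => (cycLift p a ha : Cyc p →* K)
      | true => (dihedralLift q (a ^ (p / 2)) b ht hb hab : DihedralGroup q →* K))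
    (cycLift 2 (a ^ (p / 2)) (by rwa [sq]))
    (fun i => by
      ext x
      cases i with
      | false =>
        change cycLift p a ha ((cycGen p ^ (p / 2)) ^ _) = _
        rw [map_pow, map_pow, cycLift_cycGen]
        rfl
      | true =>
        change dihedralLift q (a ^ (p / 2)) b ht hb hab (DihedralGroup.sr 0 ^ _) = _
        rw [map_pow, dihedralLift_sr_zero]
        rfl)

theorem exists_amalgam_mulEquiv {p q n : ℕ} (hp : 0 < p) (hpe : Even p) (hq : Odd q)
    (hn4 : Nat.Coprime n 4) :
    ∃ e : Amalgam p q hpe ≃* rotGroup n 4 p q,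
      (e (Amalgam.ofCyc p q hpe (cycGen p)) : SO3) = rotA p ∧
      (e (Amalgam.ofDihedral p q hpe (DihedralGroup.r 1)) : SO3) = rotB n 4 q ∧
      (e (Amalgam.ofDihedral p q hpe (DihedralGroup.sr 0)) : SO3) = rotA p ^ (p / 2) := by
  have : NeZero p := ⟨hp.ne'⟩
  have : NeZero q := ⟨hq.pos.ne'⟩
  have hhalf : p / 2 * 2 = p := Nat.div_mul_cancel hpe.two_dvd
  have hτ : rotA p ^ (p / 2) * rotA p ^ (p / 2) = 1 := by
    rw [← sq, ← pow_mul, hhalf, rotA_pow_self hp]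
  let Φ : Amalgam p q hpe →* SO3 :=
    amalgamLift p q hpe (rotA p) (rotB n 4 q) (rotA_pow_self hp) (rotB_pow_self n 4 hq.pos) hτ
      (mul_mul_eq_inv_of_mul_sq (rotA_half_mul_rotB_sq hp hpe hn4))
  have h0 : Φ (Amalgam.ofCyc p q hpe (cycGen p)) = rotA p :=
    (Monoid.PushoutI.lift_of _ _ _ (i := false) _).trans (cycLift_cycGen p _ _)
  have h1 : Φ (Amalgam.ofDihedral p q hpe (DihedralGroup.r 1)) = rotB n 4 q :=
    (Monoid.PushoutI.lift_of _ _ _ (i := true) _).trans (dihedralLift_r_one q _ _ _ _ _)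
  have hb : Amalgam.ofDihedral p q hpe (DihedralGroup.r 1) ^ q = 1 := by
    rw [← map_pow, DihedralGroup.r_one_pow_n, map_one]
  have hab : (Amalgam.ofCyc p q hpe (cycGen p) ^ (p / 2) *
      Amalgam.ofDihedral p q hpe (DihedralGroup.r 1)) ^ 2 = 1 := by
    rw [← amalgam_sr_zero, ← map_mul, ← map_pow, sq, DihedralGroup.sr_mul_r,
      DihedralGroup.sr_mul_self, map_one]
  obtain ⟨f, hf⟩ := exists_mulEquiv_rotGroup_of_half_pow Φ hp hpe h0 h1 hn4 hq
    (closure_amalgam p q hpe) (by rw [← map_pow, cycGen_pow_self, map_one]) hb hab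
  exact ⟨f, by rw [hf, h0], by rw [hf, h1], by rw [hf, amalgam_sr_zero, map_pow, h0]⟩

theorem theorem3 (p q n m : ℕ) (hp : 0 < p) (hq : 0 < q) (hn : 0 < n) (hm : 2 < m)
    (hnm : Nat.Coprime n m) :
    (((Odd p ∧ Odd q) ∨ (Even p ∧ Odd q ∧ m ≠ 4)) →
      (∃ e : PresentedGroup (freeProductRels p q) ≃* rotGroup n m p q,
        (e (PresentedGroup.of 0) : SO3) = rotA p ∧
        (e (PresentedGroup.of 1) : SO3) = rotB n m q) ∧
      (∃ e : Monoid.Coprod (Cyc p) (Cyc q) ≃* rotGroup n m p q,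
        (e (Monoid.Coprod.inl (cycGen p)) : SO3) = rotA p ∧
        (e (Monoid.Coprod.inr (cycGen q)) : SO3) = rotB n m q)) ∧
    (∀ hpe : Even p, Odd q → m = 4 →
      (∃ e : PresentedGroup (amalgamRels p q) ≃* rotGroup n m p q,
        (e (PresentedGroup.of 0) : SO3) = rotA p ∧
        (e (PresentedGroup.of 1) : SO3) = rotB n m q) ∧
      (∀ i, Function.Injective (amalgamMap p q hpe i)) ∧
      (∃ e : Amalgam p q hpe ≃* rotGroup n m p q,
        (e (Amalgam.ofCyc p q hpe (cycGen p)) : SO3) = rotA p ∧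
        (e (Amalgam.ofDihedral p q hpe (DihedralGroup.r 1)) : SO3) = rotB n m q ∧
        (e (Amalgam.ofDihedral p q hpe (DihedralGroup.sr 0)) : SO3) = rotA p ^ (p / 2))) := by
  refine ⟨fun h => ?_, ?_⟩
  · have hq' : Odd q := h.elim (·.2) (·.2.1)
    have hpm : Odd p ∨ m ≠ 4 := h.imp (·.1) (·.2.2)
    exact ⟨exists_presentedGroup_mulEquiv hp hq' hm hnm hpm,
      exists_coprod_mulEquiv hp hq' hm hnm hpm⟩
  · rintro hpe hq' rfl
    exact ⟨exists_presentedGroup_amalgam_mulEquiv hp hpe hq' hnm, amalgamMap_injective hp hpe,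
      exists_amalgam_mulEquiv hp hpe hq' hnm⟩
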